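/- Let $(\mathcal X,\|\cdot\|)$ be a separable Banach space. For $D>0$, call a function $\Psi:\mathcal X\to[0,\infty)$ $(2,D)$-smooth if $\Psi(0)=0$, $|\Psi(x+v)-\Psi(x)|\le\|v\|$ and $\Psi^2(x+v)-2\Psi^2(x)+\Psi^2(x-v)\le 2D^2\|v\|^2$ for all $x,v\in\mathcal X$; call the space $\mathcal X$ $(2,D)$-smooth if $\|x+y\|^2+\|x-y\|^2\le 2\|x\|^2+2D^2\|y\|^2$ for all $x,y\in\mathcal X$. Let $f=(f_j)_{j\ge0}$ be an $\mathcal X$-valued martingale of Bochner-integrable random vectors on a probability space with respect to a filtration $(F_j)_{j\ge0}$, with $f_0\equiv0$. Put $d_j=f_j-f_{j-1}$ for $j\ge1$, $f^*=\sup_{j\ge0}\|f_j\|$, and let $\mathbf E_{j-1}$ denote conditional expectation given $F_{j-1}$. Let $\|\cdot\|_\infty$ denote the essential supremum (values in $[0,\infty]$ are allowed, with $\exp(\infty)=\infty$). Let $\lambda>0$ be such that $\mathbf E e^{\lambda\|d_j\|}<\infty$ for all $j\ge1$. (a) If $\Psi$ is a $(2,D)$-smooth function on $\mathcal X$, then for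 all $r\ge0$ $$\mathbf P\Bigl(\sup_{j\ge0}\Psi(f_j)\ge r\Bigr)\le 2e^{-\lambda r}\Bigl\|\prod_{j=1}^\infty(1+e_j)\Bigr\|_\infty\le 2\exp\Bigl\{-\lambda r+\Bigl\|\sum_{j=1}^\infty e_j\Bigr\|_\infty\Bigr\},$$ where $e_j=(1\vee D)^2\,\mathbf E_{j-1}\bigl(e^{\lambda\|d_j\|}-1-\lambda\|d_j\|\bigr)$. (b) If the space $\mathcal X$ is $(2,D)$-smooth, then for all $r\ge0$ $$\mathbf P(f^*\ge r)\le 2e^{-\lambda r}\Bigl\|\prod_{j=1}^\infty\Bigl[1+D^2\,\mathbf E_{j-1}\bigl(e^{\lambda\|d_j\|}-1-\lambda\|d_j\|\bigr)\Bigr]\Bigr\|_\infty\le 2\exp\Bigl\{-\lambda r+D^2\Bigl\|\sum_{j=1}^\infty\mathbf E_{j-1}\bigl(e^{\lambda\|d_j\|}-1-\lambda\|d_j\|\bigr)\Bigr\|_\infty\Bigr\}.$$ -/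

import Mathlib

open MeasureTheory
open scoped ENNReal

namespace Pinelis

/-- A function `Ψ : X → [0, ∞)` on a normed space is `(2, D)`-smooth, `D > 0`. -/
structure IsTwoSmoothFun {X : Type*} [NormedAddCommGroup X] [NormedSpace ℝ X]
    (Ψ : X → ℝ) (D : ℝ) : Prop where
  pos : 0 < D
  nonneg : ∀ x, 0 ≤ Ψ x
  map_zero : Ψ 0 = 0
  lipschitz : ∀ x v, |Ψ (x + v) - Ψ x| ≤ ‖v‖
  smooth : ∀ x v, Ψ (x + v) ^ 2 - 2 * Ψ x ^ 2 + Ψ (x - v) ^ 2 ≤ 2 * D ^ 2 * ‖v‖ ^ 2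

/-- A normed space `X` is `(2, D)`-smooth, `D > 0`. -/
structure IsTwoSmoothSpace (X : Type*) [NormedAddCommGroup X] [NormedSpace ℝ X]
    (D : ℝ) : Prop where
  pos : 0 < D
  smooth : ∀ x y : X, ‖x + y‖ ^ 2 + ‖x - y‖ ^ 2 ≤ 2 * ‖x‖ ^ 2 + 2 * D ^ 2 * ‖y‖ ^ 2

/-- The increments `d_0 = 0`, `d_j = f_j - f_{j-1}` for `j ≥ 1`. -/
def increment {Ω X : Type*} [NormedAddCommGroup X] (f : ℕ → Ω → X) : ℕ → Ω → X
  | 0 => fun _ => 0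
  | j + 1 => fun ω => f (j + 1) ω - f j ω

/-- The random variable `E_{j-1} (exp (lam ‖d_j‖) - 1 - lam ‖d_j‖)` with `j = n + 1`
(so `E_{j-1}` is conditional expectation given `ℱ n`), as an element of `[0, ∞]`. -/
noncomputable def condTerm {Ω X : Type*} {mΩ : MeasurableSpace Ω} [NormedAddCommGroup X]
    (P : Measure Ω) (ℱ : Filtration ℕ mΩ) (f : ℕ → Ω → X) (lam : ℝ) (n : ℕ) (ω : Ω) : ℝ≥0∞ :=
  ENNReal.ofReal
    (condExp (ℱ n) P
      (fun ω' => Real.exp (lam * ‖increment f (n + 1) ω'‖) - 1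
        - lam * ‖increment f (n + 1) ω'‖) ω)

end Pinelis

/-! The process is `cosh (lam * Ψ (f n))`. Given the past it grows in mean by a factor of at most `1
+ e n`, so dividing by the product of these factors gives a supermartingale in the extended sense. A
maximal inequality and `cosh t ≥ exp t / 2` then yield the tail bound with its constant 2; `1 + t ≤
exp t` yields the second bound.

The growth estimate would follow from a second-order Taylor expansion, but `Ψ` need not be
differentiable. Smoothness still controls second differences of `G = cosh (lam * Ψ ·)`:
`cosh_second_diff_le`, from the scalar inequality `cosh_add_cosh_le`. The gradient is replaced by
the lower directional derivative `coshDeriv Ψ lam x`. Since second differences are O(s²), it is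
superadditive in the direction, hence concave, and it vanishes at 0; Jensen makes its mean over a
centred increment nonpositive. Summing second differences along a segment gives the upper Taylor
bound `cosh_le_taylor`, whose remainder is exactly `exp - 1 - id`. Integrating gives
`integral_cosh_le`, which is applied to the conditional law of the increment.

Each single `exp (lam * ‖d_j‖)` is integrable, but `G (f n)` is not known to be. Drift is therefore
stated through integrals in [0, ∞] against nonnegative test functions of the past. -/

namespace Pinelis

/-! ### Scalar inequalities for cosh -/

open Real in
lemma two_mul_cosh_sub_one (d : ℝ) : 2 * cosh d - 2 = 4 * sinh (d / 2) ^ 2 := by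
  have h := cosh_two_mul (d / 2)
  rw [mul_div_cancel₀ d two_ne_zero, cosh_sq] at h
  linarith

open Real in
lemma sinh_le_mul_cosh {d : ℝ} (hd : 0 ≤ d) : sinh d ≤ d * cosh d := by
  have hmono : MonotoneOn (fun x : ℝ => x * cosh x - sinh x) (Set.Ici 0) := by
    apply monotoneOn_of_deriv_nonneg (convex_Ici 0) (by fun_prop) (by fun_prop)
    intro x hx
    rw [interior_Ici] at hx
    have h : HasDerivAt (fun x : ℝ => x * cosh x - sinh x)
        (1 * cosh x + x * sinh x - cosh x) x :=
      ((hasDerivAt_id x).mul (hasDerivAt_cosh x)).sub (hasDerivAt_sinh x)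
    rw [h.deriv]
    have := mul_nonneg hx.le (sinh_nonneg_iff.2 hx.le)
    linarith
  have := hmono (Set.mem_Ici.2 le_rfl) (Set.mem_Ici.2 hd) hd
  simp at this
  linarith

open Real in
lemma sq_le_two_mul_cosh_sub_two {d : ℝ} (hd : 0 ≤ d) : d ^ 2 ≤ 2 * cosh d - 2 := by
  rw [two_mul_cosh_sub_one]
  have h := self_le_sinh_iff.2 (show 0 ≤ d / 2 by positivity)
  nlinarith

open Real in
lemma two_mul_cosh_sub_two_le {d : ℝ} (hd : 0 ≤ d) : 2 * cosh d - 2 ≤ d ^ 2 * cosh d := by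
  rw [two_mul_cosh_sub_one]
  have h := sinh_le_mul_cosh (show 0 ≤ d / 2 by positivity)
  have h0 := sinh_nonneg_iff.2 (show 0 ≤ d / 2 by positivity)
  have h2 := cosh_two_mul (d / 2)
  rw [mul_div_cancel₀ d two_ne_zero] at h2
  have h3 : sinh (d / 2) ^ 2 ≤ (d / 2 * cosh (d / 2)) ^ 2 := pow_le_pow_left₀ h0 h 2
  have h4 : cosh (d / 2) ^ 2 ≤ cosh d := by nlinarith [sq_nonneg (sinh (d / 2))]
  nlinarith [mul_le_mul_of_nonneg_left h4 (sq_nonneg d)]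

/-- `s ↦ cosh √s` is convex, written in terms of squares. -/
lemma cosh_le_convex_comb {α β u v b : ℝ} (hα : 0 ≤ α) (hβ : 0 ≤ β) (hαβ : α + β = 1)
    (hb : b ^ 2 = α * u ^ 2 + β * v ^ 2) :
    Real.cosh b ≤ α * Real.cosh u + β * Real.cosh v := by
  refine hasSum_le (fun n => ?_) (Real.hasSum_cosh b)
    (((Real.hasSum_cosh u).mul_left α).add ((Real.hasSum_cosh v).mul_left β))
  have h := (convexOn_pow n).2 (Set.mem_Ici.2 (sq_nonneg u)) (Set.mem_Ici.2 (sq_nonneg v))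
    hα hβ hαβ
  simp only [smul_eq_mul] at h
  rw [← hb, ← pow_mul, ← pow_mul, ← pow_mul] at h
  rw [← mul_div_assoc, ← mul_div_assoc, ← add_div]
  gcongr

/-- Chord bound for `s ↦ cosh √s` between `(a - d) ^ 2` and `(a + d) ^ 2`. -/
lemma cosh_le_chord {a b d : ℝ} (ha : 0 < a) (hd : 0 < d) (hb : 0 ≤ b) (hab : |b - a| ≤ d)
    (hdb : d - a ≤ b) :
    Real.cosh b ≤ Real.cosh a * Real.cosh d
      + Real.sinh a * Real.sinh d / (2 * a * d) * (b ^ 2 - a ^ 2 - d ^ 2) := by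
  obtain ⟨h1, h2⟩ := abs_le.1 hab
  have had : 0 < 4 * a * d := by positivity
  have hlo : (a - d) ^ 2 ≤ b ^ 2 := by
    rw [sq_le_sq, abs_of_nonneg hb, abs_le]; constructor <;> linarith
  have hhi : b ^ 2 ≤ (a + d) ^ 2 := by gcongr; linarith
  have h := cosh_le_convex_comb (α := (b ^ 2 - (a - d) ^ 2) / (4 * a * d))
    (β := ((a + d) ^ 2 - b ^ 2) / (4 * a * d)) (u := a + d) (v := a - d) (b := b)
    (div_nonneg (by linarith) had.le) (div_nonneg (by linarith) had.le)
    (by field_simp; ring) (by field_simp; ring)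
  rw [Real.cosh_add, Real.cosh_sub] at h
  refine h.trans_eq ?_
  field_simp
  ring

-- Scalar form of the second-difference bound, with `a`, `b`, `c` for the values of `lam * Ψ` at a
-- midpoint and two endpoints. As a function of the square, cosh lies below its chord, so the bound
-- on `b ^ 2 + c ^ 2` can be inserted linearly. The chord has height `cosh a * cosh d` at `a ^ 2 + d
-- ^ 2`, and slope at most `cosh a * cosh d / 2` because `sinh t ≤ t * cosh t`.
open Real in
lemma cosh_add_cosh_le {a b c d D : ℝ} (ha : 0 ≤ a) (hb : 0 ≤ b) (hc : 0 ≤ c) (hD : 1 ≤ D)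
    (hab : |b - a| ≤ d) (hac : |c - a| ≤ d) (hsq : b ^ 2 + c ^ 2 ≤ 2 * a ^ 2 + 2 * D ^ 2 * d ^ 2) :
    cosh b + cosh c - 2 * cosh a ≤ D ^ 2 * d ^ 2 * cosh d * cosh a := by
  have hd : 0 ≤ d := (abs_nonneg _).trans hab
  have hD2 : 1 ≤ D ^ 2 := one_le_pow₀ hD
  have hcd := cosh_pos d
  have hca := cosh_pos a
  have hchd := two_mul_cosh_sub_two_le hd
  rcases hd.eq_or_lt with rfl | hd'
  · have h1 : b = a := by have := abs_nonpos_iff.1 hab; linarith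
    have h2 : c = a := by have := abs_nonpos_iff.1 hac; linarith
    subst h1; subst h2
    simp; linarith
  rcases ha.eq_or_lt with rfl | ha'
  · have h1 : cosh b ≤ cosh d := by
      rw [cosh_le_cosh, abs_of_nonneg hd]; simpa using hab
    have h2 : cosh c ≤ cosh d := by
      rw [cosh_le_cosh, abs_of_nonneg hd]; simpa using hac
    simp only [cosh_zero]
    nlinarith [mul_nonneg (sub_nonneg.2 hD2) (mul_nonneg (sq_nonneg d) hcd.le)]
  · have hprod : cosh (d - a) + cosh (a + d) = 2 * (cosh a * cosh d) := by
      rw [cosh_sub, cosh_add]; ring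
    have hup : ∀ {x}, 0 ≤ x → |x - a| ≤ d → cosh x ≤ cosh (a + d) := fun hx hxa => by
      rw [cosh_le_cosh, abs_of_nonneg hx, abs_of_nonneg (by positivity)]
      linarith [(abs_le.1 hxa).2]
    have hlow : ∀ {x}, 0 ≤ x → x < d - a → cosh x ≤ cosh (d - a) := fun hx hxa => by
      rw [cosh_le_cosh, abs_of_nonneg hx, abs_of_nonneg (by linarith)]
      exact hxa.le
    have hsmall : cosh b + cosh c ≤ 2 * (cosh a * cosh d) →
        cosh b + cosh c - 2 * cosh a ≤ D ^ 2 * d ^ 2 * cosh d * cosh a := fun h => by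
      have h5 := mul_le_mul_of_nonneg_left hchd hca.le
      have h6 : 0 ≤ (D ^ 2 - 1) * (d ^ 2 * cosh d * cosh a) :=
        mul_nonneg (by linarith) (by positivity)
      linarith
    -- The hypotheses allow `b` or `c` below `d - a`, off the chord. That value is then bounded by
    -- `cosh (d - a)` and the other by `cosh (a + d)`.
    rcases lt_or_ge b (d - a) with hbd | hbd
    · exact hsmall (by linarith [hlow hb hbd, hup hc hac])
    rcases lt_or_ge c (d - a) with hcd | hcd
    · exact hsmall (by linarith [hlow hc hcd, hup hb hab])
    have h1 := cosh_le_chord ha' hd' hb hab hbd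
    have h2 := cosh_le_chord ha' hd' hc hac hcd
    set k := sinh a * sinh d / (2 * a * d) with hk
    have hk0 : 0 ≤ k := div_nonneg (mul_nonneg (sinh_nonneg_iff.2 ha) (sinh_nonneg_iff.2 hd))
      (by positivity)
    have hk1 : k ≤ cosh a * cosh d / 2 := by
      rw [hk, div_le_iff₀ (by positivity)]
      calc sinh a * sinh d ≤ (a * cosh a) * (d * cosh d) :=
            mul_le_mul (sinh_le_mul_cosh ha) (sinh_le_mul_cosh hd) (sinh_nonneg_iff.2 hd)
              (by positivity)
        _ = _ := by ring
    have h3 : k * (b ^ 2 + c ^ 2 - 2 * a ^ 2 - 2 * d ^ 2) ≤ k * (2 * (D ^ 2 - 1) * d ^ 2) :=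
      mul_le_mul_of_nonneg_left (by linarith) hk0
    have h4 : k * (2 * (D ^ 2 - 1) * d ^ 2) ≤ cosh a * cosh d / 2 * (2 * (D ^ 2 - 1) * d ^ 2) :=
      mul_le_mul_of_nonneg_right hk1
        (mul_nonneg (by linarith) (sq_nonneg d))
    have h5 := mul_le_mul_of_nonneg_left hchd hca.le
    linarith

open Real in
lemma cosh_add_le_exp_mul {a d : ℝ} (hd : 0 ≤ d) :
    cosh (a + d) ≤ exp d * cosh a := by
  rw [cosh_add, ← cosh_add_sinh d]
  have h : sinh a ≤ cosh a := (sinh_lt_cosh a).le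
  nlinarith [mul_le_mul_of_nonneg_right h (sinh_nonneg_iff.2 hd)]

open Real in
lemma abs_cosh_sub_cosh_le {a b M : ℝ} (ha : 0 ≤ a) (hb : 0 ≤ b) (haM : a ≤ M) (hbM : b ≤ M) :
    |cosh a - cosh b| ≤ cosh M * |a - b| := by
  have h : ∀ x ∈ Set.Icc 0 M, ‖deriv cosh x‖ ≤ cosh M := by
    intro x hx
    rw [Real.deriv_cosh, norm_eq_abs, abs_of_nonneg (sinh_nonneg_iff.2 hx.1)]
    refine (sinh_lt_cosh x).le.trans (cosh_le_cosh.2 ?_)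
    rw [abs_of_nonneg hx.1, abs_of_nonneg (ha.trans haM)]
    exact hx.2
  simpa [norm_eq_abs] using (convex_Icc 0 M).norm_image_sub_le_of_norm_deriv_le
    (fun x _ => differentiable_cosh x) h ⟨hb, hbM⟩ ⟨ha, haM⟩

/-- A concave sequence stays below the line through its first two terms. -/
lemma sub_le_nsmul_of_second_diff_nonpos {K : ℕ → ℝ}
    (h : ∀ i, K (i + 2) + K i - 2 * K (i + 1) ≤ 0) (N : ℕ) :
    K N - K 0 ≤ N * (K 1 - K 0) := by
  have h1 : ∀ i, K (i + 1) - K i ≤ K 1 - K 0 := by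
    intro i
    induction i with
    | zero => simp
    | succ i ih => have := h i; linarith
  induction N with
  | zero => simp
  | succ N ih => have := h1 N; push_cast; linarith

/-! ### Smooth functions and smooth spaces -/

open Filter Topology Real

lemma IsTwoSmoothFun.mono {X : Type*} [NormedAddCommGroup X] [NormedSpace ℝ X] {Ψ : X → ℝ}
    {D D' : ℝ} (h : IsTwoSmoothFun Ψ D) (hDD' : D ≤ D') : IsTwoSmoothFun Ψ D' where
  pos := h.pos.trans_le hDD'
  nonneg := h.nonneg
  map_zero := h.map_zero
  lipschitz := h.lipschitz
  smooth x v := (h.smooth x v).trans (by have := h.pos; gcongr)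

lemma IsTwoSmoothFun.abs_sub_le {X : Type*} [NormedAddCommGroup X] [NormedSpace ℝ X] {Ψ : X → ℝ}
    {D : ℝ} (h : IsTwoSmoothFun Ψ D) (x y : X) : |Ψ x - Ψ y| ≤ ‖x - y‖ := by
  simpa using h.lipschitz y (x - y)

lemma IsTwoSmoothFun.continuous {X : Type*} [NormedAddCommGroup X] [NormedSpace ℝ X] {Ψ : X → ℝ}
    {D : ℝ} (h : IsTwoSmoothFun Ψ D) : Continuous Ψ := by
  refine (LipschitzWith.of_dist_le_mul (K := 1) fun x y => ?_).continuous
  simpa [dist_eq_norm] using h.abs_sub_le x y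

lemma IsTwoSmoothSpace.isTwoSmoothFun_norm {X : Type*} [NormedAddCommGroup X] [NormedSpace ℝ X]
    {D : ℝ} (h : IsTwoSmoothSpace X D) : IsTwoSmoothFun (fun x : X => ‖x‖) D where
  pos := h.pos
  nonneg := norm_nonneg
  map_zero := norm_zero
  lipschitz x v := by simpa using abs_norm_sub_norm_le (x + v) x
  smooth x v := by linarith [h.smooth x v]

/-- Smoothness at the origin forces this, so part (b) can use `D` in place of `max 1 D`. -/
lemma IsTwoSmoothSpace.one_le {X : Type*} [NormedAddCommGroup X] [NormedSpace ℝ X]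
    [Nontrivial X] {D : ℝ} (h : IsTwoSmoothSpace X D) : 1 ≤ D := by
  obtain ⟨y, hy⟩ := exists_ne (0 : X)
  have h1 := h.smooth 0 y
  have h2 : 0 < ‖y‖ ^ 2 := by have := norm_pos_iff.2 hy; positivity
  simp only [zero_add, zero_sub, norm_neg, norm_zero] at h1
  have h3 : 1 ≤ D ^ 2 := le_of_mul_le_mul_right (by linarith) h2
  nlinarith [h.pos]

/-! ### First- and second-order calculus of cosh (lam * Ψ) -/

section

variable {X : Type*} [NormedAddCommGroup X] [NormedSpace ℝ X] {Ψ : X → ℝ} {D lam : ℝ}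

lemma cosh_second_diff_le (h : IsTwoSmoothFun Ψ D) (hD : 1 ≤ D) (hlam : 0 ≤ lam) (z u : X) :
    cosh (lam * Ψ (z + u)) + cosh (lam * Ψ (z - u)) - 2 * cosh (lam * Ψ z)
      ≤ D ^ 2 * (lam * ‖u‖) ^ 2 * cosh (lam * ‖u‖) * cosh (lam * Ψ z) := by
  refine cosh_add_cosh_le (mul_nonneg hlam (h.nonneg _)) (mul_nonneg hlam (h.nonneg _))
    (mul_nonneg hlam (h.nonneg _)) hD ?_ ?_ ?_
  · rw [← mul_sub, abs_mul, abs_of_nonneg hlam]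
    exact mul_le_mul_of_nonneg_left (h.lipschitz z u) hlam
  · rw [← mul_sub, abs_mul, abs_of_nonneg hlam]
    refine mul_le_mul_of_nonneg_left ?_ hlam
    simpa [sub_eq_add_neg] using h.lipschitz z (-u)
  · have := mul_le_mul_of_nonneg_left (h.smooth z u) (sq_nonneg lam)
    nlinarith

lemma cosh_le_exp_mul (h : IsTwoSmoothFun Ψ D) (hlam : 0 ≤ lam) (x u : X) :
    cosh (lam * Ψ (x + u)) ≤ exp (lam * ‖u‖) * cosh (lam * Ψ x) := by
  refine le_trans ?_ (cosh_add_le_exp_mul (mul_nonneg hlam (norm_nonneg u)))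
  have h1 := (abs_le.1 (h.lipschitz x u)).2
  have h2 := mul_nonneg hlam (h.nonneg x)
  have h3 := mul_nonneg hlam (norm_nonneg u)
  rw [cosh_le_cosh, abs_of_nonneg (mul_nonneg hlam (h.nonneg _)), abs_of_nonneg (by positivity),
    ← mul_add]
  exact mul_le_mul_of_nonneg_left (by linarith) hlam

lemma cosh_sub_le_of_subdivision (h : IsTwoSmoothFun Ψ D) (hD : 1 ≤ D) (hlam : 0 ≤ lam)
    (x v : X) {s : ℝ} (hs : 0 ≤ s) (N : ℕ) :
    cosh (lam * Ψ (x + (N * s) • v)) - cosh (lam * Ψ x)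
      ≤ N * (cosh (lam * Ψ (x + s • v)) - cosh (lam * Ψ x))
        + D ^ 2 * cosh (lam * Ψ x) * exp (lam * ‖v‖ * s)
          * (exp (lam * ‖v‖ * (N * s)) - 1 - N * (exp (lam * ‖v‖ * s) - 1)) := by
  set τ := lam * ‖v‖ with hτ
  have hτ0 : 0 ≤ τ := mul_nonneg hlam (norm_nonneg v)
  have hd : 0 ≤ τ * s := mul_nonneg hτ0 hs
  set C := D ^ 2 * cosh (lam * Ψ x) * exp (τ * s) with hC
  -- The subtracted exponential has second difference `(2 * cosh (τ * s) - 2)` times its middle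
  -- value, which dominates that of the cosh term since `(τ * s) ^ 2 ≤ 2 * cosh (τ * s) - 2`. The
  -- factor `exp (τ * s)` in `C` absorbs `cosh (τ * s)` and tends to 1 with the mesh.
  have key := sub_le_nsmul_of_second_diff_nonpos
    (K := fun i : ℕ => cosh (lam * Ψ (x + (i * s) • v)) - C * exp (τ * (i * s))) ?_ N
  · simp only [Nat.cast_zero, zero_mul, zero_smul, add_zero, mul_zero, exp_zero, Nat.cast_one,
      one_mul, mul_one] at key
    linarith
  intro i
  have h1 := cosh_second_diff_le h hD hlam (x + ((i + 1 : ℝ) * s) • v) (s • v)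
  have e1 : x + ((i + 1 : ℝ) * s) • v + s • v = x + (((i + 2 : ℕ) : ℝ) * s) • v := by
    push_cast; module
  have e2 : x + ((i + 1 : ℝ) * s) • v - s • v = x + ((i : ℝ) * s) • v := by module
  have e3 : lam * ‖s • v‖ = τ * s := by rw [norm_smul, norm_of_nonneg hs, hτ]; ring
  rw [e1, e2, e3] at h1
  have h2 : cosh (lam * Ψ (x + ((i + 1 : ℝ) * s) • v))
      ≤ exp (τ * ((i + 1) * s)) * cosh (lam * Ψ x) := by
    have := cosh_le_exp_mul h hlam x (((i + 1 : ℝ) * s) • v)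
    rwa [norm_smul, norm_of_nonneg (by positivity),
      show lam * ((i + 1 : ℝ) * s * ‖v‖) = τ * ((i + 1) * s) by rw [hτ]; ring] at this
  have h3 : cosh (τ * s) ≤ exp (τ * s) := by
    simpa using cosh_add_le_exp_mul (a := 0) hd
  have h4 := sq_le_two_mul_cosh_sub_two hd
  have h5 : D ^ 2 * (τ * s) ^ 2 * cosh (τ * s) * cosh (lam * Ψ (x + ((i + 1 : ℝ) * s) • v))
      ≤ D ^ 2 * (2 * cosh (τ * s) - 2) * exp (τ * s)
        * (exp (τ * ((i + 1) * s)) * cosh (lam * Ψ x)) := by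
    have := (cosh_pos (τ * s)).le
    have := (cosh_pos (lam * Ψ (x + ((i + 1 : ℝ) * s) • v))).le
    have : 0 ≤ 2 * cosh (τ * s) - 2 := (sq_nonneg _).trans h4
    gcongr
  have e4 : exp (τ * (((i + 2 : ℕ) : ℝ) * s)) + exp (τ * (i * s))
      = 2 * cosh (τ * s) * exp (τ * ((i + 1) * s)) := by
    rw [cosh_eq, show 2 * ((exp (τ * s) + exp (-(τ * s))) / 2) * exp (τ * ((i + 1) * s))
      = exp (τ * s) * exp (τ * ((i + 1) * s)) + exp (-(τ * s)) * exp (τ * ((i + 1) * s)) by ring,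
      ← exp_add, ← exp_add]
    push_cast
    congr 2 <;> ring
  have e5 := congrArg (fun t => C * t) e4
  simp only [Nat.cast_add, Nat.cast_one, Nat.cast_ofNat] at *
  rw [hC] at e5 ⊢
  linarith

/-- The lower directional derivative of `x ↦ cosh (lam * Ψ x)`. -/
noncomputable def coshDeriv (Ψ : X → ℝ) (lam : ℝ) (x v : X) : ℝ :=
  liminf (fun s : ℝ => (cosh (lam * Ψ (x + s • v)) - cosh (lam * Ψ x)) / s) (𝓝[>] 0)

lemma eventually_abs_cosh_sub_le (h : IsTwoSmoothFun Ψ D) (hlam : 0 ≤ lam) (x v w : X) :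
    ∀ᶠ s : ℝ in 𝓝[>] 0, |cosh (lam * Ψ (x + s • v)) - cosh (lam * Ψ (x + s • w))|
      ≤ cosh (lam * (Ψ x + 1)) * lam * ‖v - w‖ * s := by
  have hlim : Tendsto (fun s : ℝ => s * (‖v‖ + ‖w‖)) (𝓝[>] 0) (𝓝 0) := by
    have : Tendsto (fun s : ℝ => s * (‖v‖ + ‖w‖)) (𝓝 0) (𝓝 (0 * (‖v‖ + ‖w‖))) :=
      tendsto_id.mul_const _
    rw [zero_mul] at this
    exact this.mono_left nhdsWithin_le_nhds
  filter_upwards [hlim.eventually (gt_mem_nhds one_pos), self_mem_nhdsWithin] with s hs1 hs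
  have hs : 0 < s := hs
  have hbd : ∀ u : X, ‖u‖ ≤ ‖v‖ + ‖w‖ → lam * Ψ (x + s • u) ≤ lam * (Ψ x + 1) := by
    intro u hu
    refine mul_le_mul_of_nonneg_left ?_ hlam
    have h1 := (abs_le.1 (h.lipschitz x (s • u))).2
    rw [norm_smul, norm_of_nonneg hs.le] at h1
    have := mul_le_mul_of_nonneg_left hu hs.le
    linarith
  refine (abs_cosh_sub_cosh_le (mul_nonneg hlam (h.nonneg _)) (mul_nonneg hlam (h.nonneg _))
    (hbd v (by linarith [norm_nonneg w])) (hbd w (by linarith [norm_nonneg v]))).trans ?_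
  have h2 := h.abs_sub_le (x + s • v) (x + s • w)
  rw [add_sub_add_left_eq_sub, ← smul_sub, norm_smul, norm_of_nonneg hs.le] at h2
  rw [← mul_sub, abs_mul, abs_of_nonneg hlam, mul_assoc, mul_assoc]
  gcongr
  linarith

lemma eventually_abs_slope_le (h : IsTwoSmoothFun Ψ D) (hlam : 0 ≤ lam) (x v w : X) :
    ∀ᶠ s : ℝ in 𝓝[>] 0, |(cosh (lam * Ψ (x + s • v)) - cosh (lam * Ψ x)) / s
      - (cosh (lam * Ψ (x + s • w)) - cosh (lam * Ψ x)) / s|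
      ≤ cosh (lam * (Ψ x + 1)) * lam * ‖v - w‖ := by
  filter_upwards [eventually_abs_cosh_sub_le h hlam x v w, self_mem_nhdsWithin] with s hs1 hs
  have hs : 0 < s := hs
  rw [← sub_div, sub_sub_sub_cancel_right, abs_div, abs_of_pos hs, div_le_iff₀ hs]
  exact hs1

lemma eventually_abs_slope_le_norm (h : IsTwoSmoothFun Ψ D) (hlam : 0 ≤ lam) (x v : X) :
    ∀ᶠ s : ℝ in 𝓝[>] 0, |(cosh (lam * Ψ (x + s • v)) - cosh (lam * Ψ x)) / s|
      ≤ cosh (lam * (Ψ x + 1)) * lam * ‖v‖ := by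
  simpa using eventually_abs_slope_le h hlam x v 0

lemma isBoundedUnder_ge_slope (h : IsTwoSmoothFun Ψ D) (hlam : 0 ≤ lam) (x v : X) :
    IsBoundedUnder (· ≥ ·) (𝓝[>] (0 : ℝ))
      (fun s : ℝ => (cosh (lam * Ψ (x + s • v)) - cosh (lam * Ψ x)) / s) :=
  isBoundedUnder_of_eventually_ge
    ((eventually_abs_slope_le_norm h hlam x v).mono fun _ hs => (abs_le.1 hs).1)

lemma isBoundedUnder_le_slope (h : IsTwoSmoothFun Ψ D) (hlam : 0 ≤ lam) (x v : X) :
    IsBoundedUnder (· ≤ ·) (𝓝[>] (0 : ℝ))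
      (fun s : ℝ => (cosh (lam * Ψ (x + s • v)) - cosh (lam * Ψ x)) / s) :=
  isBoundedUnder_of_eventually_le
    ((eventually_abs_slope_le_norm h hlam x v).mono fun _ hs => (abs_le.1 hs).2)

lemma le_coshDeriv_iff (h : IsTwoSmoothFun Ψ D) (hlam : 0 ≤ lam) {x v : X} {c : ℝ} :
    c ≤ coshDeriv Ψ lam x v ↔ ∀ b < c, ∀ᶠ s : ℝ in 𝓝[>] 0,
      b < (cosh (lam * Ψ (x + s • v)) - cosh (lam * Ψ x)) / s :=
  le_liminf_iff (isBoundedUnder_le_slope h hlam x v).isCoboundedUnder_ge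
    (isBoundedUnder_ge_slope h hlam x v)

lemma coshDeriv_zero (x : X) : coshDeriv Ψ lam x 0 = 0 := by
  simp [coshDeriv]

lemma tendsto_const_mul_nhdsGT_zero {c : ℝ} (hc : 0 < c) :
    Tendsto (fun s : ℝ => c * s) (𝓝[>] 0) (𝓝[>] 0) := by
  refine tendsto_nhdsWithin_of_tendsto_nhds_of_eventually_within _ ?_ ?_
  · have : Tendsto (fun s : ℝ => c * s) (𝓝 0) (𝓝 (c * 0)) := tendsto_id.const_mul _
    rw [mul_zero] at this
    exact this.mono_left nhdsWithin_le_nhds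
  · filter_upwards [self_mem_nhdsWithin] with s hs
    exact mul_pos hc hs

lemma mul_coshDeriv_le_coshDeriv_smul (h : IsTwoSmoothFun Ψ D) (hlam : 0 ≤ lam) (x v : X)
    {c : ℝ} (hc : 0 < c) : c * coshDeriv Ψ lam x v ≤ coshDeriv Ψ lam x (c • v) := by
  rw [le_coshDeriv_iff h hlam]
  intro b hb
  have h1 := (le_coshDeriv_iff h hlam (x := x) (v := v)).1 le_rfl (b / c)
    (by rwa [div_lt_iff₀' hc])
  filter_upwards [(tendsto_const_mul_nhdsGT_zero hc).eventually h1, self_mem_nhdsWithin]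
    with s hs hs0
  have hs0 : 0 < s := hs0
  rw [smul_smul, mul_comm s c]
  rw [div_lt_div_iff₀ hc (by positivity)] at hs
  rw [lt_div_iff₀ hs0]
  nlinarith

/-- The points `x + 2sv` and `x + 2sw` have midpoint `x + s(v + w)`, and the second difference there
is O(s²), negligible after division by s. Lower limits are superadditive, which is why the
derivative is a `liminf`. -/
lemma coshDeriv_add_le (h : IsTwoSmoothFun Ψ D) (hD : 1 ≤ D) (hlam : 0 ≤ lam) (x v w : X) :
    coshDeriv Ψ lam x v + coshDeriv Ψ lam x w ≤ coshDeriv Ψ lam x (v + w) := by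
  rw [le_coshDeriv_iff h hlam]
  intro b hb
  obtain ⟨ε, hε, hbε⟩ : ∃ ε > 0, b = coshDeriv Ψ lam x v + coshDeriv Ψ lam x w - 3 * ε :=
    ⟨(coshDeriv Ψ lam x v + coshDeriv Ψ lam x w - b) / 3, by linarith, by ring⟩
  have hv := (le_coshDeriv_iff h hlam (x := x) (v := v)).1 le_rfl _ (sub_lt_self _ hε)
  have hw := (le_coshDeriv_iff h hlam (x := x) (v := w)).1 le_rfl _ (sub_lt_self _ hε)
  have herr : Tendsto (fun s : ℝ => D ^ 2 * (lam * ‖v - w‖) ^ 2 * cosh (lam * ‖s • (v - w)‖)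
      * cosh (lam * Ψ (x + s • (v + w))) * s) (𝓝[>] 0) (𝓝 0) := by
    have hc := h.continuous
    have : Continuous (fun s : ℝ => D ^ 2 * (lam * ‖v - w‖) ^ 2 * cosh (lam * ‖s • (v - w)‖)
      * cosh (lam * Ψ (x + s • (v + w))) * s) := by fun_prop
    have := this.tendsto 0
    simp only [mul_zero] at this
    exact this.mono_left nhdsWithin_le_nhds
  filter_upwards [(tendsto_const_mul_nhdsGT_zero two_pos).eventually hv,
    (tendsto_const_mul_nhdsGT_zero two_pos).eventually hw, herr.eventually (gt_mem_nhds hε),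
    self_mem_nhdsWithin] with s h1 h2 h3 hs
  have hs : 0 < s := hs
  have h4 := cosh_second_diff_le h hD hlam (x + s • (v + w)) (s • (v - w))
  rw [show x + s • (v + w) + s • (v - w) = x + (2 * s) • v by module,
    show x + s • (v + w) - s • (v - w) = x + (2 * s) • w by module,
    show (lam * ‖s • (v - w)‖) ^ 2 = (lam * ‖v - w‖) ^ 2 * s * s by
      rw [norm_smul, norm_of_nonneg hs.le]; ring] at h4
  rw [lt_div_iff₀ (by positivity)] at h1 h2
  rw [lt_div_iff₀ hs, hbε]
  have h5 := mul_lt_mul_of_pos_right h3 hs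
  have h6 := mul_pos hε hs
  linarith

lemma concaveOn_coshDeriv (h : IsTwoSmoothFun Ψ D) (hD : 1 ≤ D) (hlam : 0 ≤ lam) (x : X) :
    ConcaveOn ℝ Set.univ (coshDeriv Ψ lam x) := by
  refine ⟨convex_univ, fun v _ w _ a b ha hb hab => ?_⟩
  rcases ha.eq_or_lt with rfl | ha
  · obtain rfl : b = 1 := by linarith
    simp
  rcases hb.eq_or_lt with rfl | hb
  · obtain rfl : a = 1 := by linarith
    simp
  exact (add_le_add (mul_coshDeriv_le_coshDeriv_smul h hlam x v ha)
    (mul_coshDeriv_le_coshDeriv_smul h hlam x w hb)).trans (coshDeriv_add_le h hD hlam x _ _)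

lemma coshDeriv_le_add (h : IsTwoSmoothFun Ψ D) (hlam : 0 ≤ lam) (x v w : X) :
    coshDeriv Ψ lam x v ≤ coshDeriv Ψ lam x w
      + cosh (lam * (Ψ x + 1)) * lam * ‖v - w‖ := by
  rw [← sub_le_iff_le_add, le_coshDeriv_iff h hlam]
  intro b hb
  filter_upwards [eventually_abs_slope_le h hlam x v w,
    (le_coshDeriv_iff h hlam (x := x) (v := v)).1 le_rfl _ (lt_sub_iff_add_lt.1 hb)]
    with s h1 h2
  linarith [(abs_le.1 h1).2]

lemma abs_coshDeriv_sub_le (h : IsTwoSmoothFun Ψ D) (hlam : 0 ≤ lam) (x v w : X) :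
    |coshDeriv Ψ lam x v - coshDeriv Ψ lam x w|
      ≤ cosh (lam * (Ψ x + 1)) * lam * ‖v - w‖ := by
  have h1 := coshDeriv_le_add h hlam x v w
  have h2 := coshDeriv_le_add h hlam x w v
  rw [norm_sub_rev] at h2
  rw [abs_le]
  constructor <;> linarith

lemma continuous_coshDeriv (h : IsTwoSmoothFun Ψ D) (hlam : 0 ≤ lam) (x : X) :
    Continuous (coshDeriv Ψ lam x) := by
  refine (LipschitzWith.of_dist_le_mul
    (K := ⟨cosh (lam * (Ψ x + 1)) * lam, mul_nonneg (cosh_pos _).le hlam⟩) fun v w => ?_).continuous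
  rw [dist_eq_norm, dist_eq_norm]
  exact abs_coshDeriv_sub_le h hlam x v w

/-- The subdivision bound, divided by the length covered, bounds each small difference quotient from
below; the bound survives passage to the `liminf`. -/
lemma cosh_le_taylor (h : IsTwoSmoothFun Ψ D) (hD : 1 ≤ D) (hlam : 0 ≤ lam) (x v : X) :
    cosh (lam * Ψ (x + v)) ≤ cosh (lam * Ψ x) + coshDeriv Ψ lam x v
      + D ^ 2 * cosh (lam * Ψ x) * (exp (lam * ‖v‖) - 1 - lam * ‖v‖) := by
  set τ := lam * ‖v‖ with hτ
  -- With this many steps of length `s`, the subdivision covers a length tending to 1.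
  set n : ℝ → ℕ := fun s => ⌊s⁻¹⌋₊ with hn
  have hns : Tendsto (fun s : ℝ => (n s : ℝ) * s) (𝓝[>] 0) (𝓝 1) := by
    refine ((tendsto_nat_floor_div_atTop (R := ℝ)).comp tendsto_inv_nhdsGT_zero).congr fun s => ?_
    simp [hn]
  have hid : Tendsto (fun s : ℝ => s) (𝓝[>] 0) (𝓝 0) := tendsto_id.mono_left nhdsWithin_le_nhds
  have hslope : Tendsto (fun s : ℝ => (exp (τ * s) - 1) / s) (𝓝[>] 0) (𝓝 τ) := by
    have h1 : HasDerivAt (fun s : ℝ => exp (τ * s)) (exp (τ * 0) * (τ * 1)) 0 :=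
      ((hasDerivAt_id (0 : ℝ)).const_mul τ).exp
    have h2 := h1.tendsto_slope_zero_right
    simp only [mul_zero, exp_zero, mul_one, one_mul, zero_add, smul_eq_mul] at h2
    exact h2.congr fun s => by rw [div_eq_inv_mul]
  have hlim : Tendsto (fun s : ℝ => ((cosh (lam * Ψ (x + (n s * s) • v)) - cosh (lam * Ψ x))
      - D ^ 2 * cosh (lam * Ψ x) * exp (τ * s) * (exp (τ * (n s * s)) - 1
        - n s * s * ((exp (τ * s) - 1) / s))) / (n s * s)) (𝓝[>] 0)
      (𝓝 (((cosh (lam * Ψ (x + (1 : ℝ) • v)) - cosh (lam * Ψ x))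
      - D ^ 2 * cosh (lam * Ψ x) * exp (τ * 0) * (exp (τ * 1) - 1 - 1 * τ)) / 1)) := by
    have hc := h.continuous
    have hc1 : Continuous fun t : ℝ => cosh (lam * Ψ (x + t • v)) - cosh (lam * Ψ x) := by
      fun_prop
    have hc2 : Continuous fun t : ℝ => D ^ 2 * cosh (lam * Ψ x) * exp (τ * t) := by fun_prop
    have hc3 : Continuous fun t : ℝ => exp (τ * t) - 1 := by fun_prop
    exact (((hc1.tendsto 1).comp hns).sub (((hc2.tendsto 0).comp hid).mul
      (((hc3.tendsto 1).comp hns).sub (hns.mul hslope)))).div hns one_ne_zero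
  simp only [one_smul, mul_zero, exp_zero, mul_one, one_mul, div_one] at hlim
  have hle := (le_coshDeriv_iff h hlam (x := x) (v := v)
    (c := cosh (lam * Ψ (x + v)) - cosh (lam * Ψ x)
      - D ^ 2 * cosh (lam * Ψ x) * (exp τ - 1 - τ))).2 fun b hb => ?_
  · linarith
  filter_upwards [hlim.eventually (lt_mem_nhds hb), hns.eventually (lt_mem_nhds one_pos),
    self_mem_nhdsWithin] with s h1 h2 hs
  have hs : 0 < s := hs
  refine h1.trans_le ?_
  have h3 := cosh_sub_le_of_subdivision h hD hlam x v hs.le (n s)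
  rw [← hτ] at h3
  rw [div_le_div_iff₀ h2 hs, mul_assoc (n s : ℝ) s, mul_div_cancel₀ _ hs.ne']
  calc _ ≤ n s * (cosh (lam * Ψ (x + s • v)) - cosh (lam * Ψ x)) * s :=
        mul_le_mul_of_nonneg_right (by linarith) hs.le
    _ = _ := by ring

/-! ### Averaging over a centred increment -/

variable [MeasurableSpace X] [BorelSpace X] [CompleteSpace X]

lemma integral_cosh_le (h : IsTwoSmoothFun Ψ D) (hD : 1 ≤ D) (hlam : 0 ≤ lam) (x : X)
    (μ : Measure X) [IsProbabilityMeasure μ] (hint : Integrable (fun y => y) μ)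
    (hmean : ∫ y, y ∂μ = 0) (hexp : Integrable (fun y => exp (lam * ‖y‖)) μ) :
    Integrable (fun y => cosh (lam * Ψ (x + y))) μ ∧ ∫ y, cosh (lam * Ψ (x + y)) ∂μ
      ≤ (1 + D ^ 2 * ∫ y, (exp (lam * ‖y‖) - 1 - lam * ‖y‖) ∂μ) * cosh (lam * Ψ x) := by
  have hc := h.continuous
  have hi1 : Integrable (fun y => cosh (lam * Ψ (x + y))) μ := by
    refine (hexp.mul_const (cosh (lam * Ψ x))).mono' ?_ (ae_of_all _ fun y => ?_)
    · exact (by fun_prop : Continuous fun y => cosh (lam * Ψ (x + y))).aestronglyMeasurable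
    · rw [norm_of_nonneg (cosh_pos _).le]
      exact cosh_le_exp_mul h hlam x y
  have hi2 : Integrable (fun y => exp (lam * ‖y‖) - 1 - lam * ‖y‖) μ :=
    (hexp.sub (integrable_const _)).sub (hint.norm.const_mul lam)
  have hi3 : Integrable (fun y => coshDeriv Ψ lam x y) μ := by
    refine (hint.norm.const_mul (cosh (lam * (Ψ x + 1)) * lam)).mono'
      (continuous_coshDeriv h hlam x).aestronglyMeasurable (ae_of_all _ fun y => ?_)
    simpa [coshDeriv_zero] using abs_coshDeriv_sub_le h hlam x y 0
  refine ⟨hi1, ?_⟩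
  -- Jensen for a concave function vanishing at the mean 0 replaces the vanishing of a linear
  -- first-order term.
  have hjensen : ∫ y, coshDeriv Ψ lam x y ∂μ ≤ 0 := by
    have := (concaveOn_coshDeriv h hD hlam x).le_map_integral
      (continuous_coshDeriv h hlam x).continuousOn isClosed_univ (ae_of_all μ fun _ => trivial)
      hint hi3
    rwa [hmean, coshDeriv_zero] at this
  calc ∫ y, cosh (lam * Ψ (x + y)) ∂μ
      ≤ ∫ y, (cosh (lam * Ψ x) + coshDeriv Ψ lam x y
        + D ^ 2 * cosh (lam * Ψ x) * (exp (lam * ‖y‖) - 1 - lam * ‖y‖)) ∂μ :=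
        integral_mono hi1 (((integrable_const _).add hi3).add (hi2.const_mul _))
          fun y => cosh_le_taylor h hD hlam x y
    _ = cosh (lam * Ψ x) + ∫ y, coshDeriv Ψ lam x y ∂μ
        + D ^ 2 * cosh (lam * Ψ x) * ∫ y, (exp (lam * ‖y‖) - 1 - lam * ‖y‖) ∂μ := by
        have hi4 : Integrable (fun y => cosh (lam * Ψ x) + coshDeriv Ψ lam x y) μ :=
          (integrable_const _).add hi3
        rw [integral_add hi4 (hi2.const_mul _), integral_add (integrable_const _) hi3,
          integral_const_mul]
        simp
    _ ≤ _ := by linarith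

end

open Filter Topology

/-! ### Conditioning on the past -/

section Conditional

open ProbabilityTheory Real

/-- Disintegrating along `T` freezes the current position `x (T ω)`, so the deterministic estimate
`integral_cosh_le` applies to almost every conditional law of `d`. -/
lemma lintegral_mul_cosh_add_le {Ω β X : Type*} {mΩ : MeasurableSpace Ω} {mβ : MeasurableSpace β}
    [NormedAddCommGroup X] [NormedSpace ℝ X] [CompleteSpace X] [SecondCountableTopology X]
    [MeasurableSpace X] [BorelSpace X] {P : Measure Ω} [IsProbabilityMeasure P]
    {Ψ : X → ℝ} {D lam : ℝ} (h : IsTwoSmoothFun Ψ D) (hD : 1 ≤ D) (hlam : 0 ≤ lam)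
    {T : Ω → β} (hT : Measurable T) {d : Ω → X} (hd : Integrable d P)
    (hmean : P[d | mβ.comap T] =ᵐ[P] 0)
    (hexp : Integrable (fun ω => exp (lam * ‖d ω‖)) P)
    {x : β → X} (hx : Measurable x) {φ : β → ℝ≥0∞} (hφ : Measurable φ) :
    ∫⁻ ω, φ (T ω) * ENNReal.ofReal (cosh (lam * Ψ (x (T ω) + d ω))) ∂P
      ≤ ∫⁻ ω, φ (T ω) * ((1 + ENNReal.ofReal (D ^ 2) * ENNReal.ofReal
          ((P[fun ω' => exp (lam * ‖d ω'‖) - 1 - lam * ‖d ω'‖ | mβ.comap T]) ω))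
          * ENNReal.ofReal (cosh (lam * Ψ (x (T ω))))) ∂P := by
  have hdm : AEMeasurable d P := hd.1.aemeasurable
  have hΨ : Measurable Ψ := h.continuous.measurable
  set F : β × X → ℝ≥0∞ := fun p => φ p.1 * ENNReal.ofReal (cosh (lam * Ψ (x p.1 + p.2))) with hF
  have hFm : Measurable F := by
    have : Measurable fun p : β × X => x p.1 + p.2 :=
      (hx.comp measurable_fst).add measurable_snd
    exact (hφ.comp measurable_fst).mul
      (measurable_cosh.comp ((hΨ.comp this).const_mul lam)).ennreal_ofReal
  have hdis : ∫⁻ ω, F (T ω, d ω) ∂P = ∫⁻ ω, ∫⁻ y, F (T ω, y) ∂(condDistrib d T P (T ω)) ∂P := by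
    rw [← lintegral_map' hFm.aemeasurable (hT.aemeasurable.prodMk hdm),
      ← compProd_map_condDistrib hdm, Measure.lintegral_compProd hFm,
      lintegral_map hFm.lintegral_kernel_prod_right' hT]
  have hψint : Integrable (fun ω => exp (lam * ‖d ω‖) - 1 - lam * ‖d ω‖) P :=
    (hexp.sub (integrable_const _)).sub (hd.norm.const_mul lam)
  have hψc : Continuous fun y : X => exp (lam * ‖y‖) - 1 - lam * ‖y‖ := by fun_prop
  have hec : Continuous fun y : X => exp (lam * ‖y‖) := by fun_prop
  have hpair : AEMeasurable (fun ω => (T ω, d ω)) P := hT.aemeasurable.prodMk hdm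
  have hint1 : Integrable (fun p : β × X => p.2) (P.map fun ω => (T ω, d ω)) :=
    (integrable_map_measure measurable_snd.aestronglyMeasurable hpair).2 hd
  have hint2 : Integrable (fun p : β × X => exp (lam * ‖p.2‖)) (P.map fun ω => (T ω, d ω)) :=
    (integrable_map_measure (hec.measurable.comp measurable_snd).aestronglyMeasurable hpair).2 hexp
  change ∫⁻ ω, F (T ω, d ω) ∂P ≤ _
  rw [hdis]
  refine lintegral_mono_ae ?_
  filter_upwards [hmean, condExp_ae_eq_integral_condDistrib' hT hd,
    condExp_ae_eq_integral_condDistrib hT hdm hψc.stronglyMeasurable hψint,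
    hint1.condDistrib_ae hT.aemeasurable hdm,
    hint2.condDistrib_ae hT.aemeasurable hdm] with ω h1 h2 h3 h4 h5
  obtain ⟨hi, hle⟩ := integral_cosh_le h hD hlam (x (T ω)) (condDistrib d T P (T ω)) h4
    (h2.symm.trans h1) h5
  have hc := h.continuous
  rw [h3, hF]
  simp only
  rw [lintegral_const_mul _ (by fun_prop),
    ← ofReal_integral_eq_lintegral_ofReal hi (ae_of_all _ fun y => (cosh_pos _).le)]
  have hψ0 : 0 ≤ ∫ y, (exp (lam * ‖y‖) - 1 - lam * ‖y‖) ∂(condDistrib d T P (T ω)) :=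
    integral_nonneg fun y => by
      have := add_one_le_exp (lam * ‖y‖)
      simp only [Pi.zero_apply]
      linarith
  gcongr
  rw [← ENNReal.ofReal_mul (sq_nonneg D), ← ENNReal.ofReal_one,
    ← ENNReal.ofReal_add zero_le_one (by positivity), ← ENNReal.ofReal_mul (by positivity)]
  exact ENNReal.ofReal_le_ofReal hle

end Conditional

/-! ### From one-step drift to a maximal bound -/

/-- Maximal inequality for a nonnegative process with multiplicative drift at most `a`. -/
lemma mul_measure_exists_le_of_drift {Ω : Type*} {mΩ : MeasurableSpace Ω} {P : Measure Ω}
    [IsProbabilityMeasure P] {ℱ : Filtration ℕ mΩ} {M a : ℕ → Ω → ℝ≥0∞}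
    (hM : ∀ n, Measurable[ℱ n] (M n)) (ha : ∀ n, Measurable[ℱ n] (a n))
    (hM0 : ∀ ω, M 0 ω = 1) (ha1 : ∀ n ω, 1 ≤ a n ω) (hatop : ∀ n ω, a n ω ≠ ∞)
    (hdrift : ∀ n, ∀ φ : Ω → ℝ≥0∞, Measurable[ℱ n] φ →
      ∫⁻ ω, φ ω * M (n + 1) ω ∂P ≤ ∫⁻ ω, φ ω * (a n ω * M n ω) ∂P)
    {A : ℝ≥0∞} (hA0 : A ≠ 0) (hAtop : A ≠ ∞)
    (hA : ∀ᵐ ω ∂P, ∀ n, ∏ i ∈ Finset.range n, a i ω ≤ A) (c : ℝ≥0∞) :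
    c * P {ω | ∃ n, c ≤ M n ω} ≤ A := by
  set W : ℕ → Ω → ℝ≥0∞ := fun n ω => (∏ i ∈ Finset.range n, a i ω)⁻¹ with hW
  have hWm : ∀ n, Measurable[ℱ n] (W (n + 1)) := fun n =>
    Measurable.inv (Finset.measurable_prod _ fun i hi =>
      (ha i).mono (ℱ.mono (Nat.lt_succ_iff.1 (Finset.mem_range.1 hi))) le_rfl)
  have hWa : ∀ n ω, W (n + 1) ω * a n ω = W n ω := by
    intro n ω
    simp only [hW]
    rw [Finset.prod_range_succ, ENNReal.mul_inv (Or.inr (hatop n ω))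
      (Or.inr (zero_lt_one.trans_le (ha1 n ω)).ne'), mul_assoc,
      ENNReal.inv_mul_cancel (zero_lt_one.trans_le (ha1 n ω)).ne' (hatop n ω), mul_one]
  set B : ℕ → Set Ω := fun n => {ω | ∀ j < n, M j ω < c} with hB
  have hBm : ∀ n, MeasurableSet[ℱ n] (B (n + 1)) := by
    intro n
    have : B (n + 1) = ⋂ j ∈ Set.Iio (n + 1), {ω | M j ω < c} := by
      ext ω; simp [hB]
    rw [this]
    refine MeasurableSet.biInter (Set.to_countable _) fun j hj => ?_
    exact ((hM j).mono (ℱ.mono (Nat.lt_succ_iff.1 hj)) le_rfl) measurableSet_Iio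
  have hBm' : ∀ n, MeasurableSet (B n) := fun n => by
    cases n with
    | zero => simp [hB]
    | succ n => exact ℱ.le n _ (hBm n)
  have hMm : ∀ n, Measurable (M n) := fun n => (hM n).mono (ℱ.le n) le_rfl
  have hWm' : ∀ n, Measurable (W n) := fun n =>
    (Finset.measurable_prod _ fun i _ => (ha i).mono (ℱ.le i) le_rfl).inv
  have hanti : ∀ n, B (n + 1) ⊆ B n := fun n ω hω j hj => hω j (hj.trans n.lt_succ_self)
  -- The potential in `hS` is the normalised mass that has not yet reached `c`, plus a charge `t` on
  -- what has. It never increases: on a first crossing at time `n`, `M n ≥ c` and `W n ≥ A⁻¹`, so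
  -- the mass pays the charge.
  set t := c * A⁻¹ with ht
  have hS : ∀ n, ∫⁻ ω, (B n).indicator (fun ω => W n ω * M n ω) ω ∂P + t * P (B n)ᶜ ≤ 1 := by
    intro n
    induction n with
    | zero => simp [hB, hW, hM0]
    | succ n ih =>
      refine le_trans ?_ ih
      have hsplit : P (B (n + 1))ᶜ = P (B n \ B (n + 1)) + P (B n)ᶜ := by
        rw [← measure_union _ (hBm' n).compl]
        · congr 1
          ext ω
          have := @hanti n ω
          simp only [Set.mem_compl_iff, Set.mem_union, Set.mem_sdiff]
          tauto
        · exact Set.disjoint_left.2 fun ω h1 h2 => h2 h1.1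
      rw [hsplit, mul_add, ← add_assoc]
      gcongr
      -- `B (n + 1)` and `W (n + 1)` involve only times up to `n`, so their product is a legitimate
      -- test function.
      have hd := hdrift n ((B (n + 1)).indicator (W (n + 1))) ((hWm n).indicator (hBm n))
      have e1 : ∀ ω, (B (n + 1)).indicator (W (n + 1)) ω * M (n + 1) ω
          = (B (n + 1)).indicator (fun ω => W (n + 1) ω * M (n + 1) ω) ω := fun ω => by
        by_cases hω : ω ∈ B (n + 1) <;> simp [hω]
      have e2 : ∀ ω, (B (n + 1)).indicator (W (n + 1)) ω * (a n ω * M n ω)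
          = (B (n + 1)).indicator (fun ω => W n ω * M n ω) ω := fun ω => by
        by_cases hω : ω ∈ B (n + 1)
        · simp [hω, ← mul_assoc, hWa]
        · simp [hω]
      simp only [e1, e2] at hd
      refine (add_le_add_left hd _).trans ?_
      have hmeas : Measurable ((B (n + 1)).indicator fun ω => W n ω * M n ω) :=
        ((hWm' n).mul (hMm n)).indicator (hBm' (n + 1))
      rw [← lintegral_indicator_const ((hBm' n).diff (hBm' (n + 1))), ← lintegral_add_left hmeas]
      refine lintegral_mono_ae ?_
      filter_upwards [hA] with ω hω
      by_cases h1 : ω ∈ B (n + 1)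
      · simp [h1, hanti n h1]
      by_cases h2 : ω ∈ B n
      · have h3 : c ≤ M n ω := by
          by_contra hlt
          refine h1 fun j hj => ?_
          rcases (Nat.lt_succ_iff.1 hj).lt_or_eq with h | rfl
          · exact h2 j h
          · exact not_le.1 hlt
        simp only [h1, not_false_eq_true, Set.indicator_of_notMem, Set.mem_sdiff, h2, and_self,
          Set.indicator_of_mem, zero_add]
        rw [ht, mul_comm]
        exact mul_le_mul' (ENNReal.inv_le_inv.2 (hω n)) h3
      · simp [h1, h2]
  have hU : {ω | ∃ n, c ≤ M n ω} = ⋃ n, (B n)ᶜ := by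
    ext ω
    simp only [hB, Set.mem_ofPred_eq, Set.mem_iUnion, Set.mem_compl_iff, not_forall, not_lt]
    exact ⟨fun ⟨n, hn⟩ => ⟨n + 1, n, n.lt_succ_self, hn⟩, fun ⟨_, j, _, hj⟩ => ⟨j, hj⟩⟩
  have hmono : Monotone fun n => (B n)ᶜ :=
    monotone_nat_of_le_succ fun n => Set.compl_subset_compl.2 (hanti n)
  have hfin : t * P {ω | ∃ n, c ≤ M n ω} ≤ 1 := by
    rw [hU, hmono.measure_iUnion, ENNReal.mul_iSup]
    exact iSup_le fun n => le_add_self.trans (hS n)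
  rw [ht, mul_right_comm, ← div_eq_mul_inv] at hfin
  simpa using (ENNReal.div_le_iff hA0 hAtop).1 hfin

/-! ### Infinite products and exponentials in [0, ∞] -/

lemma multipliable_of_one_le {f : ℕ → ℝ≥0∞} (hf : ∀ n, 1 ≤ f n) : Multipliable f :=
  ⟨_, tendsto_atTop_iSup (f := fun s : Finset ℕ => ∏ i ∈ s, f i)
    fun _ _ hst => Finset.prod_le_prod_of_subset_of_one_le' hst fun i _ _ => hf i⟩

lemma one_add_le_ereal_exp (x : ℝ≥0∞) : 1 + x ≤ EReal.exp x := by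
  induction x with
  | top => simp
  | coe x =>
    have : ((x : ℝ≥0∞) : EReal) = ((x : ℝ) : EReal) := rfl
    rw [this, EReal.exp_coe]
    rw [← ENNReal.ofReal_coe_nnreal, ← ENNReal.ofReal_one,
      ← ENNReal.ofReal_add zero_le_one x.coe_nonneg]
    exact ENNReal.ofReal_le_ofReal (by linarith [Real.add_one_le_exp (x : ℝ)])

lemma tprod_one_add_le_ereal_exp_tsum (e : ℕ → ℝ≥0∞) :
    ∏' n, (1 + e n) ≤ EReal.exp ((∑' n, e n : ℝ≥0∞) : EReal) := by
  refine (multipliable_of_one_le fun n => le_self_add).tprod_le_of_prod_le fun s => ?_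
  have h : ∏ i ∈ s, (1 + e i) ≤ EReal.exp ((∑ i ∈ s, e i : ℝ≥0∞) : EReal) := by
    classical
    induction s using Finset.induction_on with
    | empty => simp
    | insert i s hi ih =>
      rw [Finset.prod_insert hi, Finset.sum_insert hi, EReal.coe_ennreal_add, EReal.exp_add]
      exact mul_le_mul' (one_add_le_ereal_exp _) ih
  refine h.trans (EReal.exp_monotone ?_)
  exact_mod_cast ENNReal.sum_le_tsum s

lemma essSup_tprod_one_add_le {Ω : Type*} {mΩ : MeasurableSpace Ω} (P : Measure Ω)
    (e : ℕ → Ω → ℝ≥0∞) :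
    essSup (fun ω => ∏' n, (1 + e n ω)) P
      ≤ EReal.exp ((essSup (fun ω => ∑' n, e n ω) P : ℝ≥0∞) : EReal) := by
  refine essSup_le_of_ae_le _ ?_
  filter_upwards [ENNReal.ae_le_essSup fun ω => ∑' n, e n ω] with ω hω
  refine (tprod_one_add_le_ereal_exp_tsum _).trans (EReal.exp_monotone ?_)
  exact_mod_cast hω

lemma two_mul_exp_mul_essSup_tprod_le {Ω : Type*} {mΩ : MeasurableSpace Ω} (P : Measure Ω)
    (e : ℕ → Ω → ℝ≥0∞) (y : ℝ) :
    2 * ENNReal.ofReal (Real.exp y) * essSup (fun ω => ∏' n, (1 + e n ω)) P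
      ≤ 2 * EReal.exp ((y : EReal) + ((essSup (fun ω => ∑' n, e n ω) P : ℝ≥0∞) : EReal)) := by
  rw [EReal.exp_add, EReal.exp_coe, mul_assoc]
  gcongr
  exact essSup_tprod_one_add_le P e

lemma measurable_condTerm {Ω X : Type*} {mΩ : MeasurableSpace Ω} [NormedAddCommGroup X]
    {P : Measure Ω} {ℱ : Filtration ℕ mΩ} {f : ℕ → Ω → X} (lam : ℝ) (n : ℕ) :
    Measurable[ℱ n] (condTerm P ℱ f lam n) :=
  (stronglyMeasurable_condExp.measurable).ennreal_ofReal

/-! ### The tail bound for martingales -/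

section Martingale

variable {Ω X : Type*} {mΩ : MeasurableSpace Ω} {P : Measure Ω} [IsProbabilityMeasure P]
  [NormedAddCommGroup X] [NormedSpace ℝ X] [CompleteSpace X]
  {ℱ : Filtration ℕ mΩ} {f : ℕ → Ω → X}

lemma condExp_increment (hf : Martingale f ℱ P) (n : ℕ) :
    P[increment f (n + 1) | ℱ n] =ᵐ[P] 0 := by
  have h1 : P[f n | ℱ n] = f n :=
    condExp_of_stronglyMeasurable (ℱ.le n) (hf.1 n) (hf.integrable n)
  filter_upwards [condExp_sub (hf.integrable (n + 1)) (hf.integrable n) (ℱ n),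
    hf.2 n (n + 1) n.le_succ] with ω h2 h3
  change (P[f (n + 1) - f n | ℱ n]) ω = 0
  rw [h2, Pi.sub_apply, h3, h1, sub_self]

variable [SecondCountableTopology X] {Ψ : X → ℝ} {D lam : ℝ}

lemma lintegral_mul_cosh_succ_le (h : IsTwoSmoothFun Ψ D) (hD : 1 ≤ D)
    (hf : Martingale f ℱ P) (hlam : 0 ≤ lam) (n : ℕ)
    (hexp : Integrable (fun ω => Real.exp (lam * ‖increment f (n + 1) ω‖)) P)
    {φ : Ω → ℝ≥0∞} (hφ : Measurable[ℱ n] φ) :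
    ∫⁻ ω, φ ω * ENNReal.ofReal (Real.cosh (lam * Ψ (f (n + 1) ω))) ∂P
      ≤ ∫⁻ ω, φ ω * ((1 + ENNReal.ofReal (D ^ 2) * condTerm P ℱ f lam n ω)
          * ENNReal.ofReal (Real.cosh (lam * Ψ (f n ω)))) ∂P := by
  borelize X
  have hmean : P[increment f (n + 1) | (ℱ n).comap id] =ᵐ[P] 0 := by
    rw [MeasurableSpace.comap_id]; exact condExp_increment hf n
  have hd : Integrable (increment f (n + 1)) P :=
    (hf.integrable (n + 1)).sub (hf.integrable n)
  -- Here `T` is the identity from `Ω` to `Ω` carrying `ℱ n`; it generates `ℱ n`, and `f n` and `φ`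
  -- are functions of it.
  have := lintegral_mul_cosh_add_le (mβ := ℱ n) h hD hlam (measurable_id'' (ℱ.le n)) hd hmean
    hexp (hf.1 n).measurable hφ
  rw [MeasurableSpace.comap_id] at this
  simpa [increment, condTerm] using this

/-- The tail bound for `(2, D)`-smooth functions of a martingale, `D ≥ 1`. -/
lemma measure_le_iSup_smooth_le (h : IsTwoSmoothFun Ψ D) (hD : 1 ≤ D)
    (hf : Martingale f ℱ P) (hf0 : ∀ ω, f 0 ω = 0) (hlam : 0 ≤ lam)
    (hexp : ∀ j : ℕ, 1 ≤ j → Integrable (fun ω => Real.exp (lam * ‖increment f j ω‖)) P)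
    (r : ℝ) :
    P {ω | ENNReal.ofReal r ≤ ⨆ j, ENNReal.ofReal (Ψ (f j ω))}
      ≤ 2 * ENNReal.ofReal (Real.exp (-(lam * r)))
        * essSup (fun ω => ∏' n, (1 + ENNReal.ofReal (D ^ 2) * condTerm P ℱ f lam n ω)) P := by
  borelize X
  set A := essSup (fun ω => ∏' n, (1 + ENNReal.ofReal (D ^ 2) * condTerm P ℱ f lam n ω)) P with hA
  by_cases hAtop : A = ∞
  · rw [hAtop, ENNReal.mul_top]
    · exact le_top
    · simp [Real.exp_pos]
  have hprod : ∀ᵐ ω ∂P, ∀ n, ∏ i ∈ Finset.range n,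
      (1 + ENNReal.ofReal (D ^ 2) * condTerm P ℱ f lam i ω) ≤ A := by
    filter_upwards [ENNReal.ae_le_essSup
      fun ω => ∏' n, (1 + ENNReal.ofReal (D ^ 2) * condTerm P ℱ f lam n ω)] with ω hω n
    exact ((multipliable_of_one_le fun n => le_self_add).prod_le_tprod _
      fun i _ => le_self_add).trans hω
  have hA0 : A ≠ 0 := by
    obtain ⟨ω, hω⟩ := hprod.exists
    exact (zero_lt_one.trans_le (by simpa using hω 0)).ne'
  have hΨ : Measurable Ψ := h.continuous.measurable
  have key : ∀ c : ℝ≥0∞,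
      c * P {ω | ∃ n, c ≤ ENNReal.ofReal (Real.cosh (lam * Ψ (f n ω)))} ≤ A := by
    refine mul_measure_exists_le_of_drift (ℱ := ℱ)
      (M := fun n ω => ENNReal.ofReal (Real.cosh (lam * Ψ (f n ω))))
      (a := fun n ω => 1 + ENNReal.ofReal (D ^ 2) * condTerm P ℱ f lam n ω)
      (fun n => ?_) (fun n => ?_) (fun ω => ?_) (fun n ω => le_self_add) (fun n ω => ?_)
      (fun n φ hφ => lintegral_mul_cosh_succ_le h hD hf hlam n (hexp _ n.succ_pos) hφ)
      hA0 hAtop hprod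
    · exact (Real.measurable_cosh.comp
        ((hΨ.comp (hf.1 n).measurable).const_mul lam)).ennreal_ofReal
    · exact ((measurable_condTerm lam n).const_mul _).const_add _
    · simp [hf0, h.map_zero]
    · exact ENNReal.add_ne_top.2
        ⟨ENNReal.one_ne_top, ENNReal.mul_ne_top ENNReal.ofReal_ne_top ENNReal.ofReal_ne_top⟩
  -- The supremum may equal `r` without being attained, so a level `r' < r` is used first and then
  -- `r'` tends to `r`.
  have hlt : ∀ r' < r, P {ω | ENNReal.ofReal r ≤ ⨆ j, ENNReal.ofReal (Ψ (f j ω))}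
      ≤ 2 * ENNReal.ofReal (Real.exp (-(lam * r'))) * A := by
    intro r' hr'
    have hsub : {ω | ENNReal.ofReal r ≤ ⨆ j, ENNReal.ofReal (Ψ (f j ω))}
        ⊆ {ω | ∃ n, ENNReal.ofReal (Real.exp (lam * r') / 2)
          ≤ ENNReal.ofReal (Real.cosh (lam * Ψ (f n ω)))} := by
      intro ω hω
      obtain ⟨n, hn⟩ : ∃ n, r' ≤ Ψ (f n ω) := by
        by_contra! hcon
        have hr'0 : 0 < r' := (h.nonneg _).trans_lt (hcon 0)
        have h1 : ⨆ j, ENNReal.ofReal (Ψ (f j ω)) ≤ ENNReal.ofReal r' :=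
          iSup_le fun j => ENNReal.ofReal_le_ofReal (hcon j).le
        exact absurd (hω.trans h1)
          (not_le.2 ((ENNReal.ofReal_lt_ofReal_iff (hr'0.trans hr')).2 hr'))
      refine ⟨n, ENNReal.ofReal_le_ofReal ?_⟩
      rw [Real.cosh_eq]
      have h1 : Real.exp (lam * r') ≤ Real.exp (lam * Ψ (f n ω)) :=
        Real.exp_le_exp.2 (mul_le_mul_of_nonneg_left hn hlam)
      have h2 := (Real.exp_pos (-(lam * Ψ (f n ω)))).le
      linarith
    refine (measure_mono hsub).trans ?_
    have hk := key (ENNReal.ofReal (Real.exp (lam * r') / 2))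
    calc P {ω | ∃ n, ENNReal.ofReal (Real.exp (lam * r') / 2)
          ≤ ENNReal.ofReal (Real.cosh (lam * Ψ (f n ω)))}
        = 2 * ENNReal.ofReal (Real.exp (-(lam * r'))) * (ENNReal.ofReal (Real.exp (lam * r') / 2)
          * P {ω | ∃ n, ENNReal.ofReal (Real.exp (lam * r') / 2)
          ≤ ENNReal.ofReal (Real.cosh (lam * Ψ (f n ω)))}) := by
          have e : 2 * ENNReal.ofReal (Real.exp (-(lam * r')))
              * ENNReal.ofReal (Real.exp (lam * r') / 2) = 1 := by
            rw [show (2 : ℝ≥0∞) = ENNReal.ofReal 2 by simp, ← ENNReal.ofReal_mul two_pos.le,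
              ← ENNReal.ofReal_mul (by positivity), Real.exp_neg]
            rw [← ENNReal.ofReal_one]
            congr 1
            field_simp
          rw [← mul_assoc, e, one_mul]
      _ ≤ _ := by gcongr
  have hlim : Tendsto (fun r' : ℝ => 2 * ENNReal.ofReal (Real.exp (-(lam * r'))) * A) (𝓝[<] r)
      (𝓝 (2 * ENNReal.ofReal (Real.exp (-(lam * r))) * A)) := by
    have hc : Continuous fun r' : ℝ => ENNReal.ofReal (Real.exp (-(lam * r'))) :=
      ENNReal.continuous_ofReal.comp (by fun_prop)
    exact (ENNReal.Tendsto.mul_const (ENNReal.Tendsto.const_mul (hc.tendsto r)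
      (Or.inr (by simp))) (Or.inr hAtop)).mono_left nhdsWithin_le_nhds
  refine ge_of_tendsto hlim ?_
  filter_upwards [self_mem_nhdsWithin] with r' hr'
  exact hlt r' hr'

end Martingale

lemma one_le_essSup_tprod {Ω : Type*} {mΩ : MeasurableSpace Ω} (P : Measure Ω)
    [IsProbabilityMeasure P] (e : ℕ → Ω → ℝ≥0∞) :
    1 ≤ essSup (fun ω => ∏' n, (1 + e n ω)) P := by
  obtain ⟨ω, hω⟩ := (ENNReal.ae_le_essSup (μ := P) fun ω => ∏' n, (1 + e n ω)).exists
  exact (one_le_tprod fun n => le_self_add).trans hω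

end Pinelis

/-! ### Assembly of both bounds -/

theorem theorem3p2
    {Ω : Type*} {mΩ : MeasurableSpace Ω} (P : Measure Ω) [IsProbabilityMeasure P]
    {X : Type*} [NormedAddCommGroup X] [NormedSpace ℝ X] [CompleteSpace X]
    [TopologicalSpace.SeparableSpace X]
    (ℱ : Filtration ℕ mΩ) (f : ℕ → Ω → X)
    (hf : Martingale f ℱ P) (hf0 : ∀ ω, f 0 ω = 0)
    (lam : ℝ) (hlam : 0 < lam)
    (hexp : ∀ j : ℕ, 1 ≤ j →
      Integrable (fun ω => Real.exp (lam * ‖Pinelis.increment f j ω‖)) P) :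
    -- the bound for a smooth function on an arbitrary separable Banach space
    (∀ (Ψ : X → ℝ) (D : ℝ), Pinelis.IsTwoSmoothFun Ψ D →
      ∀ e : ℕ → Ω → ℝ≥0∞,
        -- `e n` is the quantity written `e_j` with `j = n + 1`
        (∀ n ω, e n ω = ENNReal.ofReal ((max 1 D) ^ 2) * Pinelis.condTerm P ℱ f lam n ω) →
      ∀ r : ℝ, 0 ≤ r →
        P {ω | ENNReal.ofReal r ≤ ⨆ j, ENNReal.ofReal (Ψ (f j ω))}
            ≤ 2 * ENNReal.ofReal (Real.exp (-(lam * r)))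
              * essSup (fun ω => ∏' n, (1 + e n ω)) P
        ∧ 2 * ENNReal.ofReal (Real.exp (-(lam * r)))
              * essSup (fun ω => ∏' n, (1 + e n ω)) P
            ≤ 2 * EReal.exp (((-(lam * r) : ℝ) : EReal)
              + ((essSup (fun ω => ∑' n, e n ω) P : ℝ≥0∞) : EReal)))
    ∧
    -- the bound for the norm when the space itself is smooth
    (∀ D : ℝ, Pinelis.IsTwoSmoothSpace X D →
      ∀ r : ℝ, 0 ≤ r →
        P {ω | ENNReal.ofReal r ≤ ⨆ j, ENNReal.ofReal ‖f j ω‖}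
            ≤ 2 * ENNReal.ofReal (Real.exp (-(lam * r)))
              * essSup (fun ω => ∏' n,
                  (1 + ENNReal.ofReal (D ^ 2) * Pinelis.condTerm P ℱ f lam n ω)) P
        ∧ 2 * ENNReal.ofReal (Real.exp (-(lam * r)))
              * essSup (fun ω => ∏' n,
                  (1 + ENNReal.ofReal (D ^ 2) * Pinelis.condTerm P ℱ f lam n ω)) P
            ≤ 2 * EReal.exp (((-(lam * r) : ℝ) : EReal)
              + ((ENNReal.ofReal (D ^ 2)
                  * essSup (fun ω => ∑' n, Pinelis.condTerm P ℱ f lam n ω) P : ℝ≥0∞) : EReal))) := by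
  have := UniformSpace.secondCountable_of_separable X
  refine ⟨fun Ψ D h e he r _ => ?_, fun D h r hr => ⟨?_, ?_⟩⟩
  · obtain rfl : e = fun n ω =>
        ENNReal.ofReal ((max 1 D) ^ 2) * Pinelis.condTerm P ℱ f lam n ω := by
      funext n ω; exact he n ω
    exact ⟨Pinelis.measure_le_iSup_smooth_le (h.mono (le_max_right 1 D)) (le_max_left 1 D)
      hf hf0 hlam.le hexp r, Pinelis.two_mul_exp_mul_essSup_tprod_le P _ _⟩
  -- On the zero space `D < 1` is possible, so the general bound is unavailable; there the event is
  -- empty for `r > 0`, and for `r = 0` the right side is at least 1.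
  · rcases subsingleton_or_nontrivial X with hX | hX
    · rcases hr.eq_or_lt with rfl | hr
      · have h1 := Pinelis.one_le_essSup_tprod P
          fun n ω => ENNReal.ofReal (D ^ 2) * Pinelis.condTerm P ℱ f lam n ω
        simp only [mul_zero, neg_zero, Real.exp_zero, ENNReal.ofReal_one, mul_one]
        exact prob_le_one.trans (h1.trans (le_mul_of_one_le_left zero_le one_le_two))
      · have hempty : {ω | ENNReal.ofReal r ≤ ⨆ j, ENNReal.ofReal ‖f j ω‖} = ∅ := by
          simp [Subsingleton.elim _ (0 : X), Set.eq_empty_iff_forall_notMem, hr]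
        rw [hempty, measure_empty]
        exact zero_le
    · exact Pinelis.measure_le_iSup_smooth_le h.isTwoSmoothFun_norm h.one_le hf hf0 hlam.le hexp r
  · have h1 := Pinelis.two_mul_exp_mul_essSup_tprod_le P
      (fun n ω => ENNReal.ofReal (D ^ 2) * Pinelis.condTerm P ℱ f lam n ω) (-(lam * r))
    simp only [ENNReal.tsum_mul_left] at h1
    rwa [ENNReal.essSup_const_mul] at h1
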